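/- Let the integers $w_3(n)$ ($n\ge 0$) be defined by $$\sum_{n=0}^{\infty} w_3(n)\,q^n=\frac{(q^2;q^2)_\infty}{(q;q^2)_\infty^4\,(q^3;q^3)_\infty^2},\qquad\text{where } (a;q)_\infty=\prod_{n=0}^{\infty}(1-aq^n).$$ Then for all integers $n\ge 0$, $$w_3(24n+23)\equiv 0\pmod{27}.$$ -/

import Mathlib

open scoped PowerSeries PowerSeries.WithPiTopology

namespace WeightedPartition

/-- The `q`-shifted factorial `(a; q)_∞ = ∏_{n ≥ 0} (1 - a q ^ n)` for formal power series `a`, `q`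
with integer coefficients, as an infinite product in the topology of coefficientwise convergence.
The product converges when `q` has zero constant term, see `multipliable_qPoch`. -/
noncomputable def qPoch (a q : ℤ⟦X⟧) : ℤ⟦X⟧ := ∏' n : ℕ, (1 - a * q ^ n)

/-- The denominator `(q; q ^ 2)_∞ ^ 4 (q ^ t; q ^ t)_∞ ^ 2`, with `q = X`. -/
noncomputable def denom (t : ℕ) : ℤ⟦X⟧ :=
  qPoch PowerSeries.X (PowerSeries.X ^ 2) ^ 4 *
    qPoch (PowerSeries.X ^ t) (PowerSeries.X ^ t) ^ 2

/-- The generating function `(q ^ 2; q ^ 2)_∞ / ((q; q ^ 2)_∞ ^ 4 (q ^ t; q ^ t)_∞ ^ 2)`.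
For `t ≥ 1` the denominator has constant term `1`, so that `PowerSeries.invOfUnit _ 1` is its
inverse, see `genFun_mul_denom`. -/
noncomputable def genFun (t : ℕ) : ℤ⟦X⟧ :=
  qPoch (PowerSeries.X ^ 2) (PowerSeries.X ^ 2) * PowerSeries.invOfUnit (denom t) 1

/-- The weighted 7-colored partition function `w_t(n)`, for `t ≥ 1`: the coefficient of `q ^ n` in
the generating function. -/
noncomputable def w (t n : ℕ) : ℤ := PowerSeries.coeff n (genFun t)

theorem multipliable_qPoch (a q : ℤ⟦X⟧) (hq : PowerSeries.constantCoeff q = 0) :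
    Multipliable fun n : ℕ => 1 - a * q ^ n := by
  simp_rw [sub_eq_add_neg]
  apply PowerSeries.WithPiTopology.multipliable_one_add_of_tendsto_order_atTop_nhds_top
  refine ENat.tendsto_nhds_top_iff_natCast_lt.mpr fun n => Filter.eventually_atTop.mpr
    ⟨n + 1, fun m hm => ?_⟩
  have h1 : (m : ℕ∞) ≤ (q ^ m).order := PowerSeries.le_order_pow_of_constantCoeff_eq_zero m hq
  have h2 : (q ^ m).order ≤ (-(a * q ^ m)).order := by
    rw [PowerSeries.order_neg]
    exact le_trans le_add_self (PowerSeries.le_order_mul _ _)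
  exact lt_of_lt_of_le (by exact_mod_cast hm) (h1.trans h2)

theorem constantCoeff_qPoch (a q : ℤ⟦X⟧) (ha : PowerSeries.constantCoeff a = 0)
    (hq : PowerSeries.constantCoeff q = 0) : PowerSeries.constantCoeff (qPoch a q) = 1 := by
  rw [qPoch, (multipliable_qPoch a q hq).map_tprod PowerSeries.constantCoeff
    (PowerSeries.WithPiTopology.continuous_constantCoeff ℤ)]
  simp [ha]

theorem constantCoeff_denom (t : ℕ) (ht : t ≠ 0) : PowerSeries.constantCoeff (denom t) = 1 := by
  have h : PowerSeries.constantCoeff ((PowerSeries.X : ℤ⟦X⟧) ^ t) = 0 := by simp [ht]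
  simp [denom, constantCoeff_qPoch _ _ h h, constantCoeff_qPoch]

/-- The defining property of the generating function, with the denominator cleared. -/
theorem genFun_mul_denom (t : ℕ) (ht : t ≠ 0) :
    genFun t * denom t = qPoch (PowerSeries.X ^ 2) (PowerSeries.X ^ 2) := by
  rw [genFun, mul_assoc, mul_comm (PowerSeries.invOfUnit _ _),
    PowerSeries.mul_invOfUnit _ _ (by simp [constantCoeff_denom t ht]), mul_one]

end WeightedPartition

/-! Write `E_k = (q^k; q^k)_∞`, `φ(-q) = E_1^2/E_2` and `ψ(q) = E_2^2/E_1`. The generating function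
is `ψ(q)^2 / (φ(-q) E_3^2)`.

Factor 9: the 3-dissections are `φ(-q) = P - 2qO` and `ψ(q) = a + qψ(q^9)`, with `P = φ(-q^9)` and
`O`, `a` series in `q^3`. Multiplying numerator and denominator by `P^2 + 2qPO + 4q^2O^2` turns the
denominator into a series in `q^3`. Since `aO` and `ψ(q^9)P` both equal `E_9 E_18`, the terms with
exponent 2 mod 3 have numerator `(1 + 4 + 4) q^2 E_9^2 E_18^2` (`exists_residuePart_genFun_three`).

Factor 3: modulo 3, `E_k^3 ≡ E_{3k}` reduces the remaining quotient to `q^2 φ(-q^3) E_6^2 E_18^2`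
(`exists_nine_mul_eq_residuePart`). By a 2-dissection of `φ(-q)φ(-q^3)`, the exponents in this
series are `2 + 3j^2 + 12k` or `8 + 3j^2 + 24k`. Neither can be `24n + 23`, because squares are 0, 1
or 4 mod 8 (`coeff_theta_mul_eq_zero`).

The product forms of the theta series come from the Jacobi triple product, obtained as the limit of
its finite form. -/

namespace WeightedPartition

open PowerSeries Finset Filter

/-! ### Theta series and the Jacobi triple product -/

/-- The triangular number `j (j + 1) / 2` of an integer `j`. -/
def triangular (j : ℤ) : ℕ := (j * (j + 1) / 2).toNat

theorem two_mul_triangular (j : ℤ) : 2 * (triangular j : ℤ) = j * (j + 1) := by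
  have h : 0 ≤ j * (j + 1) := by
    rcases le_or_gt 0 j with h | h
    · positivity
    · exact mul_nonneg_of_nonpos_of_nonpos h.le (by lia)
  rw [triangular, Int.toNat_of_nonneg (by lia),
    Int.mul_ediv_cancel' (Int.even_mul_succ_self j).two_dvd]

/-- The general term `a ^ (j (j + 1) / 2) * b ^ (j (j - 1) / 2)` of Ramanujan's theta series. -/
def thetaTerm {R : Type*} [CommRing R] (a b : R) (j : ℤ) : R :=
  a ^ triangular j * b ^ triangular (-j)

/-- Ramanujan's theta series `∑ a ^ (j (j + 1) / 2) * b ^ (j (j - 1) / 2)`. -/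
noncomputable def theta (a b : ℤ⟦X⟧) : ℤ⟦X⟧ := ∑' j : ℤ, thetaTerm a b j

theorem thetaTerm_step_sub {R : Type*} [CommRing R] (a b : R) (n : ℕ) (j : ℤ) (h : j ≤ n + 1) :
    a * (a * b) ^ n * thetaTerm a b (j - 1) = (a * b) ^ (n + 1 - j).toNat * thetaTerm a b j := by
  have h1 := two_mul_triangular j
  have h2 := two_mul_triangular (-j)
  have h3 := two_mul_triangular (j - 1)
  have h4 := two_mul_triangular (-(j - 1))
  have e1 : 1 + n + triangular (j - 1) = (n + 1 - j).toNat + triangular j := by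
    zify; rw [Int.toNat_of_nonneg (by lia)]; linarith
  have e2 : n + triangular (-(j - 1)) = (n + 1 - j).toNat + triangular (-j) := by
    zify; rw [Int.toNat_of_nonneg (by lia)]; linarith
  calc _ = a ^ (1 + n + triangular (j - 1)) * b ^ (n + triangular (-(j - 1))) := by
        rw [thetaTerm]; ring
    _ = _ := by rw [e1, e2, thetaTerm]; ring

theorem thetaTerm_neg {R : Type*} [CommRing R] (a b : R) (j : ℤ) :
    thetaTerm a b (-j) = thetaTerm b a j := by
  rw [thetaTerm, thetaTerm, neg_neg, mul_comm]

theorem thetaTerm_step_add {R : Type*} [CommRing R] (a b : R) (n : ℕ) (j : ℤ) (h : -j ≤ n + 1) :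
    b * (a * b) ^ n * thetaTerm a b (j + 1) = (a * b) ^ (n + 1 + j).toNat * thetaTerm a b j := by
  have := thetaTerm_step_sub b a n (-j) h
  rw [← thetaTerm_neg a b (-j - 1), ← thetaTerm_neg a b, mul_comm b a] at this
  convert this using 3 <;> ring_nf

/-- `∏_{i < k} (1 - q ^ (i + 1))` -/
def qFact {R : Type*} [CommRing R] (q : R) (k : ℕ) : R := ∏ i ∈ range k, (1 - q ^ (i + 1))

theorem qFact_succ {R : Type*} [CommRing R] (q : R) (k : ℕ) :
    qFact q (k + 1) = qFact q k * (1 - q ^ (k + 1)) := prod_range_succ _ _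

/-- A bilateral sequence behaving like the inverses of the `q`-factorials. -/
structure IsInvQFact {R : Type*} [CommRing R] (q : R) (r : ℤ → R) : Prop where
  of_neg : ∀ k < 0, r k = 0
  mul_eq_one : ∀ k : ℕ, qFact q k * r k = 1

namespace IsInvQFact

variable {R : Type*} [CommRing R] {q : R} {r : ℤ → R}

theorem zero (h : IsInvQFact q r) : r 0 = 1 := by simpa [qFact] using h.mul_eq_one 0

theorem sub_one (h : IsInvQFact q r) (k : ℤ) : r (k - 1) = (1 - q ^ k.toNat) * r k := by
  rcases lt_or_ge k 0 with hk | hk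
  · rw [h.of_neg k hk, h.of_neg _ (by lia), mul_zero]
  · obtain ⟨m, rfl⟩ := Int.eq_ofNat_of_zero_le hk
    cases m with
    | zero => simpa using h.of_neg (-1) (by lia)
    | succ m =>
      have h1 := h.mul_eq_one m
      have h2 := h.mul_eq_one (m + 1)
      rw [qFact_succ] at h2
      have e : ((m + 1 : ℕ) : ℤ) - 1 = m := by push_cast; ring
      rw [e, Int.toNat_natCast]
      linear_combination (1 - q ^ (m + 1)) * r ((m + 1 : ℕ) : ℤ) * h1 - r m * h2

end IsInvQFact

/-- Two applications of the `q`-Pascal rule with `q = ab`: the three terms on the right are the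
contributions to index `j` when the product is multiplied by `(1 + a q^n)(1 + b q^n)`. -/
theorem finite_triple_product_step {R : Type*} [CommRing R] {a b : R} {r : ℤ → R}
    (h : IsInvQFact (a * b) r) (n : ℕ) (j : ℤ) :
    qFact (a * b) (2 * (n + 1)) * r ((n + 1 : ℕ) - j) * r ((n + 1 : ℕ) + j) * thetaTerm a b j =
      (1 + (a * b) ^ (2 * n + 1)) *
          (qFact (a * b) (2 * n) * r (n - j) * r (n + j) * thetaTerm a b j) +
        a * (a * b) ^ n *
          (qFact (a * b) (2 * n) * r (n - (j - 1)) * r (n + (j - 1)) * thetaTerm a b (j - 1)) +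
        b * (a * b) ^ n *
          (qFact (a * b) (2 * n) * r (n - (j + 1)) * r (n + (j + 1)) * thetaTerm a b (j + 1)) := by
  have s1 := thetaTerm_step_sub a b n j
  have s2 := thetaTerm_step_add a b n j
  generalize a * b = q at *
  have hF : qFact q (2 * (n + 1)) =
      qFact q (2 * n) * (1 - q ^ (2 * n + 1)) * (1 - q ^ (2 * n + 2)) := by
    rw [mul_add, mul_one, qFact_succ, qFact_succ]
  have a1 := h.sub_one (n + 1 - j)
  have a2 := h.sub_one (n - j)
  have b1 := h.sub_one (n + 1 + j)
  have b2 := h.sub_one (n + j)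
  rw [show (n : ℤ) + 1 - j - 1 = n - j by ring] at a1
  rw [show (n : ℤ) + 1 + j - 1 = n + j by ring] at b1
  rw [show (n : ℤ) - j - 1 = n - (j + 1) by ring] at a2
  rw [show (n : ℤ) + j - 1 = n + (j - 1) by ring] at b2
  rw [hF, show ((n + 1 : ℕ) : ℤ) - j = n + 1 - j by push_cast; ring,
    show ((n + 1 : ℕ) : ℤ) + j = n + 1 + j by push_cast; ring,
    show (n : ℤ) - (j - 1) = n + 1 - j by ring, show (n : ℤ) + (j + 1) = n + 1 + j by ring,
    a2, b2, a1, b1]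
  rcases lt_or_ge ((n : ℤ) + 1 - j) 0 with hj | hj
  · simp [h.of_neg _ hj]
  rcases lt_or_ge ((n : ℤ) + 1 + j) 0 with hj' | hj'
  · simp [h.of_neg _ hj']
  have s1 := s1 (by lia)
  have s2 := s2 (by lia)
  generalize thetaTerm a b (j - 1) = t1 at *
  generalize thetaTerm a b (j + 1) = t2 at *
  generalize thetaTerm a b j = t at *
  generalize r (n + 1 - j) = x at *
  generalize r (n + 1 + j) = y at *
  generalize qFact q (2 * n) = F at *
  obtain ⟨u, hu⟩ := Int.eq_ofNat_of_zero_le hj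
  obtain ⟨v, hv⟩ := Int.eq_ofNat_of_zero_le hj'
  rw [hu, Int.toNat_natCast] at s1 ⊢
  rw [hv, Int.toNat_natCast] at s2 ⊢
  -- The truncation in `u - 1` and `v - 1` is harmless: at `u = 0` or `v = 0` the accompanying
  -- factor `1 - q ^ u` or `1 - q ^ v` vanishes.
  rw [show ((n : ℤ) - j).toNat = u - 1 by lia, show ((n : ℤ) + j).toNat = v - 1 by lia]
  suffices H : (1 - q ^ (2 * n + 1)) * (1 - q ^ (2 * n + 2)) =
      (1 + q ^ (2 * n + 1)) * (1 - q ^ u) * (1 - q ^ v) +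
        q ^ u * (1 - q ^ (v - 1)) * (1 - q ^ v) + q ^ v * (1 - q ^ (u - 1)) * (1 - q ^ u) by
    linear_combination F * x * y * t * H - F * x * y * (1 - q ^ (v - 1)) * (1 - q ^ v) * s1
      - F * x * y * (1 - q ^ (u - 1)) * (1 - q ^ u) * s2
  have huv : u + v = 2 * n + 2 := by lia
  rw [← huv]
  rcases u with _ | u
  · rcases v with _ | v
    · lia
    · rw [show 2 * n + 1 = v by lia]; simp
  · rcases v with _ | v
    · rw [show 2 * n + 1 = u by lia]; simp
    · rw [show 2 * n + 1 = u + v + 1 by lia]; simp; ring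

/-- The finite form of the Jacobi triple product identity. -/
theorem hasSum_finite_triple_product {R : Type*} [CommRing R] [TopologicalSpace R]
    [IsTopologicalRing R] {a b : R} {r : ℤ → R} (h : IsInvQFact (a * b) r) (n : ℕ) :
    HasSum (fun j : ℤ => qFact (a * b) (2 * n) * r (n - j) * r (n + j) * thetaTerm a b j)
      (∏ k ∈ range n, ((1 + a * (a * b) ^ k) * (1 + b * (a * b) ^ k))) := by
  induction n with
  | zero =>
    rw [prod_range_zero]
    convert hasSum_ite_eq (0 : ℤ) (1 : R) using 2 with j
    split_ifs with hj
    · simp [hj, h.zero, qFact, thetaTerm, triangular]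
    · rcases lt_or_gt_of_ne hj with h' | h'
      · simp [h.of_neg j h']
      · simp [h.of_neg (-j) (by lia)]
  | succ n ih =>
    have h1 := ih.mul_left (1 + (a * b) ^ (2 * n + 1))
    have h2 := ((Equiv.subRight (1 : ℤ)).hasSum_iff.mpr ih).mul_left (a * (a * b) ^ n)
    have h3 := ((Equiv.addRight (1 : ℤ)).hasSum_iff.mpr ih).mul_left (b * (a * b) ^ n)
    have h4 := (h1.add h2).add h3
    rw [show (fun j : ℤ => qFact (a * b) (2 * (n + 1)) * r ((n + 1 : ℕ) - j) *
      r ((n + 1 : ℕ) + j) * thetaTerm a b j) = _ from funext (finite_triple_product_step h n)]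
    convert! h4 using 1
    rw [prod_range_succ]; ring

theorem isClosed_X_pow_dvd (n : ℕ) : IsClosed {f : ℤ⟦X⟧ | X ^ n ∣ f} := by
  simp_rw [X_pow_dvd_iff, Set.ofPred_forall]
  exact isClosed_iInter fun m => isClosed_iInter fun _ =>
    isClosed_eq (WithPiTopology.continuous_coeff ℤ m) continuous_const

theorem X_pow_dvd_of_hasSum {ι : Type*} {f : ι → ℤ⟦X⟧} {s : ℤ⟦X⟧} {n : ℕ} (hf : HasSum f s)
    (h : ∀ i, X ^ n ∣ f i) : X ^ n ∣ s :=
  (isClosed_X_pow_dvd n).mem_of_tendsto hf (Eventually.of_forall fun _ => dvd_sum fun i _ => h i)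

theorem summable_of_finite_not_dvd {ι : Type*} {f : ι → ℤ⟦X⟧}
    (h : ∀ n, {i | ¬ X ^ n ∣ f i}.Finite) : Summable f := by
  rw [WithPiTopology.summable_iff_summable_coeff]
  refine fun n => summable_of_hasFiniteSupport ((h (n + 1)).subset fun i hi hd => hi ?_)
  exact X_pow_dvd_iff.mp hd n (Nat.lt_succ_self n)

/-- Both exponents are at least `|j|(|j| - 1)/2`, so a power of `ab` can be extracted. Assuming only
`X ∣ a * b` admits `a = 1`, needed for `2ψ(q) = theta 1 q`. -/
theorem X_pow_dvd_thetaTerm {a b : ℤ⟦X⟧} (h : X ∣ a * b) (j : ℤ) {n : ℕ}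
    (hn : (2 * n : ℤ) ≤ |j| * (|j| - 1)) : X ^ n ∣ thetaTerm a b j := by
  have h1 := two_mul_triangular j
  have h2 := two_mul_triangular (-j)
  have h3 : n ≤ triangular j ∧ n ≤ triangular (-j) := by
    rcases abs_cases j with ⟨h, _⟩ | ⟨h, _⟩ <;> rw [h] at hn <;> constructor <;> zify <;> nlinarith
  refine (pow_dvd_pow_of_dvd h n).trans ?_
  rw [mul_pow, thetaTerm]
  exact mul_dvd_mul (pow_dvd_pow _ h3.1) (pow_dvd_pow _ h3.2)

theorem finite_not_dvd_thetaTerm {a b : ℤ⟦X⟧} (h : X ∣ a * b) (n : ℕ) :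
    {j | ¬ X ^ n ∣ thetaTerm a b j}.Finite := by
  refine (Set.finite_Icc (-(2 * n + 1) : ℤ) (2 * n + 1)).subset fun j hj => ?_
  by_contra hc
  refine hj (X_pow_dvd_thetaTerm h j ?_)
  have : (2 * n + 1 : ℤ) ≤ |j| := by
    rw [Set.mem_Icc] at hc
    rcases abs_cases j with ⟨h, _⟩ | ⟨h, _⟩ <;> lia
  nlinarith

theorem hasSum_theta {a b : ℤ⟦X⟧} (h : X ∣ a * b) : HasSum (thetaTerm a b) (theta a b) :=
  (summable_of_finite_not_dvd (finite_not_dvd_thetaTerm h)).hasSum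

theorem tendsto_qPoch (a q : ℤ⟦X⟧) (hq : X ∣ q) :
    Tendsto (fun n => ∏ k ∈ range n, (1 - a * q ^ k)) atTop (nhds (qPoch a q)) :=
  (multipliable_qPoch a q (X_dvd_iff.mp hq)).hasProd.tendsto_prod_nat

theorem X_pow_dvd_qFact_sub {q : ℤ⟦X⟧} (hq : X ∣ q) {n m : ℕ} (h : n ≤ m) :
    X ^ (n + 1) ∣ qFact q m - qFact q n := by
  induction m, h using Nat.le_induction with
  | base => simp
  | succ m h ih =>
    rw [qFact_succ, show qFact q m * (1 - q ^ (m + 1)) - qFact q n =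
      (qFact q m - qFact q n) - qFact q m * q ^ (m + 1) by ring]
    exact dvd_sub ih (((pow_dvd_pow X (by lia)).trans (pow_dvd_pow_of_dvd hq (m + 1))).mul_left _)

theorem X_pow_dvd_qPoch_sub_qFact {q : ℤ⟦X⟧} (hq : X ∣ q) (n : ℕ) :
    X ^ (n + 1) ∣ qPoch q q - qFact q n := by
  refine (isClosed_X_pow_dvd (n + 1)).mem_of_tendsto ((tendsto_qPoch q q hq).sub_const _) ?_
  filter_upwards [eventually_ge_atTop n] with m hm
  simpa only [Set.mem_ofPred_eq, qFact, pow_succ'] using X_pow_dvd_qFact_sub hq hm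

theorem exists_isInvQFact {q : ℤ⟦X⟧} (hq : X ∣ q) : ∃ r : ℤ → ℤ⟦X⟧, IsInvQFact q r := by
  refine ⟨fun k => if k < 0 then 0 else invOfUnit (qFact q k.toNat) 1, fun k hk => if_pos hk,
    fun k => ?_⟩
  rw [if_neg (by lia), Int.toNat_natCast, mul_invOfUnit]
  simp [qFact, X_dvd_iff.mp hq, map_prod]

theorem dvd_mul_sub_one {R : Type*} [CommRing R] {d x y : R} (hx : d ∣ x - 1) (hy : d ∣ y - 1) :
    d ∣ x * y - 1 := by
  rw [show x * y - 1 = (x - 1) * y + (y - 1) by ring]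
  exact dvd_add (hx.mul_right _) hy

/-- The central `q`-binomial coefficients tend to `1/(q; q)_∞`. Convergence is poor for `|j|` near
`n`, but there the theta term itself is highly divisible by `X`; the two orders add up to at least
`n`. -/
theorem X_pow_dvd_triple_product_error {a b : ℤ⟦X⟧} {r : ℤ → ℤ⟦X⟧} (hq : X ∣ a * b)
    (h : IsInvQFact (a * b) r) (n : ℕ) (j : ℤ) :
    X ^ n ∣ qPoch (a * b) (a * b) *
      (qFact (a * b) (2 * n) * r (n - j) * r (n + j) * thetaTerm a b j) - thetaTerm a b j := by
  rcases lt_or_ge (n : ℤ) |j| with hj | hj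
  · have : r (n - j) * r (n + j) = 0 := by
      rcases abs_cases j with ⟨h1, _⟩ | ⟨h1, _⟩
      · rw [h.of_neg (n - j) (by lia), zero_mul]
      · rw [h.of_neg (n + j) (by lia), mul_zero]
    rw [mul_assoc (qFact _ _), this, mul_zero, zero_mul, mul_zero, zero_sub, dvd_neg]
    exact X_pow_dvd_thetaTerm hq j (by nlinarith [Int.le_self_sq (n : ℤ)])
  · obtain ⟨u, hu⟩ := Int.eq_ofNat_of_zero_le (show 0 ≤ (n : ℤ) - j by linarith [le_abs_self j])
    obtain ⟨v, hv⟩ := Int.eq_ofNat_of_zero_le (show 0 ≤ (n : ℤ) + j by linarith [neg_abs_le j])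
    obtain ⟨m, hm⟩ := Int.eq_ofNat_of_zero_le (abs_nonneg j)
    have hmu : n - m + 1 ≤ u + 1 := by have := le_abs_self j; lia
    have hmv : n - m + 1 ≤ v + 1 := by have := neg_abs_le j; lia
    have e1 : X ^ (n - m + 1) ∣ qPoch (a * b) (a * b) * r u - 1 := by
      rw [← h.mul_eq_one u, ← sub_mul]
      exact ((pow_dvd_pow X hmu).trans (X_pow_dvd_qPoch_sub_qFact hq u)).mul_right _
    have e2 : X ^ (n - m + 1) ∣ qFact (a * b) (2 * n) * r v - 1 := by
      rw [← h.mul_eq_one v, ← sub_mul]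
      exact ((pow_dvd_pow X hmv).trans (X_pow_dvd_qFact_sub hq (by lia))).mul_right _
    have e3 : X ^ (m - 1) ∣ thetaTerm a b j := by
      refine X_pow_dvd_thetaTerm hq j ?_
      rw [hm]
      rcases m with _ | _ | m
      · simp
      · simp
      · push_cast [Nat.add_sub_cancel]; nlinarith
    rw [hu, hv]
    refine (pow_dvd_pow X (show n ≤ n - m + 1 + (m - 1) by lia)).trans ?_
    rw [pow_add]
    convert! mul_dvd_mul (dvd_mul_sub_one e1 e2) e3 using 1
    ring

/-- The Jacobi triple product identity. -/
theorem theta_eq_qPoch {a b : ℤ⟦X⟧} (hq : X ∣ a * b) :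
    theta a b = qPoch (-a) (a * b) * qPoch (-b) (a * b) * qPoch (a * b) (a * b) := by
  obtain ⟨r, hr⟩ := exists_isInvQFact hq
  have key (n : ℕ) : X ^ n ∣ qPoch (a * b) (a * b) *
      (∏ k ∈ range n, ((1 + a * (a * b) ^ k) * (1 + b * (a * b) ^ k))) - theta a b :=
    X_pow_dvd_of_hasSum (((hasSum_finite_triple_product hr n).mul_left _).sub (hasSum_theta hq))
      (X_pow_dvd_triple_product_error hq hr n)
  have lim := (((tendsto_qPoch (-a) _ hq).mul (tendsto_qPoch (-b) _ hq)).const_mul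
    (qPoch (a * b) (a * b))).sub_const (theta a b)
  simp only [neg_mul, sub_neg_eq_add, ← prod_mul_distrib] at lim
  have h0 : qPoch (a * b) (a * b) * (qPoch (-a) (a * b) * qPoch (-b) (a * b)) - theta a b = 0 := by
    ext d
    refine X_pow_dvd_iff.mp ((isClosed_X_pow_dvd (d + 1)).mem_of_tendsto lim ?_) d (by lia)
    filter_upwards [eventually_ge_atTop (d + 1)] with n hn
    exact (pow_dvd_pow X hn).trans (key n)
  linear_combination -h0

/-! ### Dissections of theta series and of their products -/

theorem hasSum_of_bijective_sumElim {ι α β γ : Type*} {f : ι → ℤ⟦X⟧} {g₁ : α → ι} {g₂ : β → ι}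
    {g₃ : γ → ι} (hg : Function.Bijective (Sum.elim g₁ (Sum.elim g₂ g₃)))
    {f₁ : α → ℤ⟦X⟧} {f₂ : β → ℤ⟦X⟧} {f₃ : γ → ℤ⟦X⟧} {s₁ s₂ s₃ : ℤ⟦X⟧}
    (h₁ : HasSum f₁ s₁) (h₂ : HasSum f₂ s₂) (h₃ : HasSum f₃ s₃)
    (e₁ : ∀ i, f (g₁ i) = f₁ i) (e₂ : ∀ i, f (g₂ i) = f₂ i) (e₃ : ∀ i, f (g₃ i) = f₃ i) :
    HasSum f (s₁ + (s₂ + s₃)) := by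
  obtain rfl := funext e₁
  obtain rfl := funext e₂
  obtain rfl := funext e₃
  rw [← (Equiv.ofBijective _ hg).hasSum_iff]
  exact HasSum.sum h₁ (HasSum.sum h₂ h₃)

theorem bijective_residues_three : Function.Bijective
    (Sum.elim (fun k : ℤ => 3 * k) (Sum.elim (fun k : ℤ => 3 * k + 1) fun k : ℤ => 3 * k + 2)) := by
  constructor
  · rintro (a | a | a) (b | b | b) h <;> simp at h ⊢ <;> lia
  · intro b
    obtain h | h | h : b % 3 = 0 ∨ b % 3 = 1 ∨ b % 3 = 2 := by lia
    · exact ⟨.inl (b / 3), by simp; lia⟩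
    · exact ⟨.inr (.inl (b / 3)), by simp; lia⟩
    · exact ⟨.inr (.inr (b / 3)), by simp; lia⟩

theorem thetaTerm_pow_pow {R : Type*} [CommRing R] (p : R) (i k : ℕ) (j : ℤ) :
    thetaTerm (p ^ i) (p ^ k) j = p ^ (i * triangular j + k * triangular (-j)) := by
  rw [thetaTerm, ← pow_mul, ← pow_mul, pow_add]

theorem hasSum_theta_pow {p : ℤ⟦X⟧} (hp : X ∣ p) {i k : ℕ} (h : i + k ≠ 0) (e : ℤ ≃ ℤ) :
    HasSum (fun j => p ^ (i * triangular (e j) + k * triangular (-(e j))))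
      (theta (p ^ i) (p ^ k)) := by
  simp_rw [← thetaTerm_pow_pow]
  exact e.hasSum_iff.mpr (hasSum_theta (by rw [← pow_add]; exact dvd_pow hp h))

/-- The 3-dissection of `φ(-q)`, with `p = -q`. -/
theorem theta_self_dissection {p : ℤ⟦X⟧} (hp : X ∣ p) :
    theta p p = theta (p ^ 9) (p ^ 9) + 2 * p * theta (p ^ 3) (p ^ 15) := by
  have h0 := hasSum_theta_pow hp (i := 1) (k := 1) (by simp) (Equiv.refl ℤ)
  have h1 := hasSum_theta_pow hp (i := 9) (k := 9) (by simp) (Equiv.refl ℤ)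
  -- Both `(3k + 1)^2` and `(3k + 2)^2` have the form `9l^2 - 6l + 1`, with `l = -k` and `l = k +
  -- 1`; hence the two reindexings.
  have h2 := (hasSum_theta_pow hp (i := 3) (k := 15) (by simp) (Equiv.neg ℤ)).mul_left p
  have h3 := (hasSum_theta_pow hp (i := 3) (k := 15) (by simp) (Equiv.addRight 1)).mul_left p
  simp only [Equiv.refl_apply, Equiv.neg_apply, Equiv.coe_addRight, ← pow_succ'] at h0 h1 h2 h3
  rw [pow_one] at h0
  rw [h0.unique (hasSum_of_bijective_sumElim bijective_residues_three h1 h2 h3 ?_ ?_ ?_)]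
  · ring
  · intro k
    have t1 := two_mul_triangular (3 * k)
    have t2 := two_mul_triangular (-(3 * k))
    have t3 := two_mul_triangular k
    have t4 := two_mul_triangular (-k)
    congr 1; zify; linarith
  · intro k
    have t1 := two_mul_triangular (3 * k + 1)
    have t2 := two_mul_triangular (-(3 * k + 1))
    have t3 := two_mul_triangular (-k)
    have t4 := two_mul_triangular (- -k)
    congr 1; zify; linarith
  · intro k
    have t1 := two_mul_triangular (3 * k + 2)
    have t2 := two_mul_triangular (-(3 * k + 2))
    have t3 := two_mul_triangular (k + 1)
    have t4 := two_mul_triangular (-(k + 1))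
    congr 1; zify; linarith

/-- The 3-dissection of `2 ψ(q)`. -/
theorem theta_one_dissection {q : ℤ⟦X⟧} (hq : X ∣ q) :
    theta 1 q = 2 * theta (q ^ 3) (q ^ 6) + q * theta 1 (q ^ 9) := by
  have h0 := hasSum_theta_pow hq (i := 0) (k := 1) (by simp) (Equiv.refl ℤ)
  have h1 := hasSum_theta_pow hq (i := 3) (k := 6) (by simp) (Equiv.refl ℤ)
  have h2 := hasSum_theta_pow hq (i := 3) (k := 6) (by simp) (Equiv.neg ℤ)
  have h3 := (hasSum_theta_pow hq (i := 0) (k := 9) (by simp) (Equiv.neg ℤ)).mul_left q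
  simp only [Equiv.refl_apply, Equiv.neg_apply, ← pow_succ'] at h0 h1 h2 h3
  rw [pow_zero] at h0 h3
  rw [pow_one] at h0
  rw [h0.unique (hasSum_of_bijective_sumElim bijective_residues_three h1 h2 h3 ?_ ?_ ?_)]
  · ring
  · intro k
    have t2 := two_mul_triangular (-(3 * k))
    have t3 := two_mul_triangular k
    have t4 := two_mul_triangular (-k)
    congr 1; zify; linarith
  · intro k
    have t2 := two_mul_triangular (-(3 * k + 1))
    have t3 := two_mul_triangular (-k)
    have t4 := two_mul_triangular (- -k)
    congr 1; zify; linarith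
  · intro k
    have t2 := two_mul_triangular (-(3 * k + 2))
    have t4 := two_mul_triangular (- -k)
    congr 1; zify; linarith

theorem summable_mul {ι κ : Type*} {f : ι → ℤ⟦X⟧} {g : κ → ℤ⟦X⟧}
    (hf : ∀ n, {i | ¬ X ^ n ∣ f i}.Finite) (hg : ∀ n, {i | ¬ X ^ n ∣ g i}.Finite) :
    Summable fun x : ι × κ => f x.1 * g x.2 :=
  summable_of_finite_not_dvd fun n => ((hf n).prod (hg n)).subset fun _ hx =>
    ⟨fun h => hx (h.mul_right _), fun h => hx (h.mul_left _)⟩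

/-- Regularity of the coefficientwise topology allows two unordered sums to be multiplied. -/
instance : T3Space ℤ⟦X⟧ := inferInstanceAs (T3Space ((Unit →₀ ℕ) → ℤ))

theorem hasSum_theta_mul_theta {p : ℤ⟦X⟧} (hp : X ∣ p) {i k i' k' : ℕ} (h : i + k ≠ 0)
    (h' : i' + k' ≠ 0) :
    HasSum (fun x : ℤ × ℤ => p ^ (i * triangular x.1 + k * triangular (-x.1) +
      (i' * triangular x.2 + k' * triangular (-x.2))))
      (theta (p ^ i) (p ^ k) * theta (p ^ i') (p ^ k')) := by
  have h1 : X ∣ p ^ i * p ^ k := by rw [← pow_add]; exact dvd_pow hp h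
  have h2 : X ∣ p ^ i' * p ^ k' := by rw [← pow_add]; exact dvd_pow hp h'
  have := (hasSum_theta h1).mul (hasSum_theta h2)
    (summable_mul (finite_not_dvd_thetaTerm h1) (finite_not_dvd_thetaTerm h2))
  simpa only [thetaTerm_pow_pow, ← pow_add] using this

/-- Splits pairs `(m, n)` by `m - n`: even, 1 mod 4, 3 mod 4. The last two classes are exchanged by
negation, which preserves `m^2 + 3n^2`. -/
theorem bijective_parity : Function.Bijective
    (Sum.elim (fun x : ℤ × ℤ => (x.1 + 2 * x.2, x.1))
      (Sum.elim (fun x : ℤ × ℤ => (1 - x.1 - 3 * x.2, x.2 - x.1))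
        fun x : ℤ × ℤ => (-(1 - x.1 - 3 * x.2), -(x.2 - x.1)))) := by
  constructor
  · rintro (⟨a, b⟩ | ⟨a, b⟩ | ⟨a, b⟩) (⟨c, d⟩ | ⟨c, d⟩ | ⟨c, d⟩) h <;> simp at h ⊢ <;> lia
  · rintro ⟨m, n⟩
    obtain h | h | h : (m - n) % 2 = 0 ∨ (m - n) % 4 = 1 ∨ (m - n) % 4 = 3 := by lia
    · exact ⟨.inl (n, (m - n) / 2), by simp; lia⟩
    · exact ⟨.inr (.inl (-n - (m - n) / 4, -((m - n) / 4))), by simp; lia⟩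
    · exact ⟨.inr (.inr (n - (n - m) / 4, -((n - m) / 4))), by simp; lia⟩

/-- The exponent of the product is `m^2 + 3n^2`. On the odd classes the substitution separates it as
`1 + (4x^2 - 2x) + (12y^2 - 6y)`, giving the same product of theta series twice. -/
theorem theta_mul_theta_dissection {p : ℤ⟦X⟧} (hp : X ∣ p) :
    ∃ (e : ℤ × ℤ → ℕ) (E : ℤ⟦X⟧), HasSum (fun x => (p ^ 2) ^ e x) E ∧
      theta p p * theta (p ^ 3) (p ^ 3) =
        E + 2 * p * (theta (p ^ 2) (p ^ 6) * theta (p ^ 6) (p ^ 18)) := by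
  have h0 := hasSum_theta_mul_theta hp (i := 1) (k := 1) (i' := 3) (k' := 3) (by simp) (by simp)
  have h1 := (hasSum_theta_mul_theta hp (i := 2) (k := 6) (i' := 6) (k' := 18) (by simp)
    (by simp)).mul_left p
  rw [pow_one] at h0
  simp only [← pow_succ'] at h1
  let g : ℤ × ℤ → ℤ × ℤ := fun x => (x.1 + 2 * x.2, x.1)
  have hg : Function.Injective g := by
    rintro ⟨a, b⟩ ⟨c, d⟩ h
    simp [g] at h ⊢; lia
  have hE := (h0.summable.comp_injective hg).hasSum
  -- With `m = x + 2y` and `n = x`, `m^2 + 3n^2 = 4(x^2 + xy + y^2)`.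
  refine ⟨fun x => (2 * (x.1 ^ 2 + x.1 * x.2 + x.2 ^ 2)).toNat, _, ?_,
    (h0.unique (hasSum_of_bijective_sumElim bijective_parity hE h1 h1 (fun _ => rfl) ?_ ?_)).trans
      (by ring)⟩
  · convert! hE using 2 with x
    have t1 := two_mul_triangular (x.1 + 2 * x.2)
    have t2 := two_mul_triangular (-(x.1 + 2 * x.2))
    have t3 := two_mul_triangular x.1
    have t4 := two_mul_triangular (-x.1)
    rw [← pow_mul]
    dsimp only [Function.comp_apply, g]
    congr 1
    zify
    rw [Int.toNat_of_nonneg (by nlinarith [sq_nonneg (x.1 + x.2), sq_nonneg x.1, sq_nonneg x.2])]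
    linarith
  · intro x
    have t1 := two_mul_triangular (1 - x.1 - 3 * x.2)
    have t2 := two_mul_triangular (-(1 - x.1 - 3 * x.2))
    have t3 := two_mul_triangular (x.2 - x.1)
    have t4 := two_mul_triangular (-(x.2 - x.1))
    have t5 := two_mul_triangular x.1
    have t6 := two_mul_triangular (-x.1)
    have t7 := two_mul_triangular x.2
    have t8 := two_mul_triangular (-x.2)
    congr 1; zify; linarith
  · intro x
    have t1 := two_mul_triangular (1 - x.1 - 3 * x.2)
    have t2 := two_mul_triangular (-(1 - x.1 - 3 * x.2))
    have t3 := two_mul_triangular (x.2 - x.1)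
    have t4 := two_mul_triangular (-(x.2 - x.1))
    have t5 := two_mul_triangular x.1
    have t6 := two_mul_triangular (-x.1)
    have t7 := two_mul_triangular x.2
    have t8 := two_mul_triangular (-x.2)
    rw [neg_neg, neg_neg]
    congr 1; zify; linarith

/-! ### Product formulas for the theta series -/

theorem qPoch_eq_prod_residues (a q : ℤ⟦X⟧) (hq : X ∣ q) {m : ℕ} (hm : m ≠ 0) :
    qPoch a q = ∏ i ∈ range m, qPoch (a * q ^ i) (q ^ m) := by
  have h1 := tendsto_finsetProd (range m) fun i _ =>
    tendsto_qPoch (a * q ^ i) (q ^ m) (dvd_pow hq hm)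
  refine tendsto_nhds_unique ((tendsto_qPoch a q hq).comp
    (tendsto_id.const_mul_atTop' (Nat.pos_of_ne_zero hm))) (h1.congr fun n => ?_)
  dsimp only [Function.comp_apply, id]
  induction n with
  | zero => simp
  | succ n ih =>
    simp_rw [prod_range_succ _ n, prod_mul_distrib, ih, mul_add, mul_one, prod_range_add]
    congr 1
    refine prod_congr rfl fun i _ => ?_
    rw [pow_add, pow_mul]
    ring

theorem qPoch_two (a q : ℤ⟦X⟧) (hq : X ∣ q) :
    qPoch a q = qPoch a (q ^ 2) * qPoch (a * q) (q ^ 2) := by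
  rw [qPoch_eq_prod_residues a q hq two_ne_zero]
  simp [prod_range_succ]

theorem qPoch_three (a q : ℤ⟦X⟧) (hq : X ∣ q) :
    qPoch a q = qPoch a (q ^ 3) * qPoch (a * q) (q ^ 3) * qPoch (a * q ^ 2) (q ^ 3) := by
  rw [qPoch_eq_prod_residues a q hq three_ne_zero]
  simp [prod_range_succ]

theorem qPoch_mul_qPoch_neg (a q : ℤ⟦X⟧) (hq : X ∣ q) :
    qPoch a q * qPoch (-a) q = qPoch (a ^ 2) (q ^ 2) := by
  refine tendsto_nhds_unique ((tendsto_qPoch a q hq).mul (tendsto_qPoch (-a) q hq))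
    ((tendsto_qPoch (a ^ 2) (q ^ 2) (dvd_pow hq two_ne_zero)).congr fun n => ?_)
  rw [← prod_mul_distrib]
  exact prod_congr rfl fun i _ => by ring

theorem qPoch_succ (a q : ℤ⟦X⟧) (hq : X ∣ q) : qPoch a q = (1 - a) * qPoch (a * q) q := by
  refine tendsto_nhds_unique ((tendsto_qPoch a q hq).comp (tendsto_add_atTop_nat 1))
    (((tendsto_qPoch (a * q) q hq).const_mul (1 - a)).congr fun n => ?_)
  rw [Function.comp_apply, prod_range_succ', mul_comm]
  congr 1
  · exact prod_congr rfl fun i _ => by ring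
  · simp

theorem qPoch_ne_zero {a q : ℤ⟦X⟧} (ha : X ∣ a) (hq : X ∣ q) : qPoch a q ≠ 0 := fun h => by
  simpa [h] using constantCoeff_qPoch a q (X_dvd_iff.mp ha) (X_dvd_iff.mp hq)

/-- Euler's product `(q; q)_∞`. -/
noncomputable def euler (q : ℤ⟦X⟧) : ℤ⟦X⟧ := qPoch q q

theorem euler_ne_zero {q : ℤ⟦X⟧} (hq : X ∣ q) : euler q ≠ 0 := qPoch_ne_zero hq hq

theorem qPoch_sq_mul_euler {q : ℤ⟦X⟧} (hq : X ∣ q) :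
    qPoch q (q ^ 2) * euler (q ^ 2) = euler q := by
  rw [euler, euler, qPoch_two q q hq, sq]

theorem qPoch_neg_mul_euler {q : ℤ⟦X⟧} (hq : X ∣ q) :
    qPoch (-q) q * euler q = euler (q ^ 2) := by
  rw [euler, mul_comm, qPoch_mul_qPoch_neg q q hq, euler]

theorem theta_neg_neg_mul {q : ℤ⟦X⟧} (hq : X ∣ q) :
    theta (-q) (-q) * euler (q ^ 2) = euler q ^ 2 := by
  rw [theta_eq_qPoch (by simpa using hq.mul_right q), neg_neg, neg_mul_neg, ← sq,
    ← qPoch_sq_mul_euler hq, euler]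
  ring_nf

theorem theta_one_mul {q : ℤ⟦X⟧} (hq : X ∣ q) :
    theta 1 q * euler q = 2 * euler (q ^ 2) ^ 2 := by
  rw [theta_eq_qPoch (by simpa using hq), one_mul, qPoch_succ _ _ hq,
    ← qPoch_neg_mul_euler hq, euler, neg_one_mul]
  ring

/-- The product form of `ψ(q)`: `(-q; q^4)` and `(-q^3; q^4)` combine to `(-q; q^2)`, and `(q;
q^2)(-q; q^2) = (q^2; q^4)`. -/
theorem theta_pow_three_mul {q : ℤ⟦X⟧} (hq : X ∣ q) :
    theta q (q ^ 3) * euler q = euler (q ^ 2) ^ 2 := by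
  have h4 : q * q ^ 3 = q ^ 4 := by ring
  have hq2 : X ∣ q ^ 2 := dvd_pow hq two_ne_zero
  have h1 := qPoch_two (-q) (q ^ 2) hq2
  have h2 := qPoch_mul_qPoch_neg q (q ^ 2) hq2
  have h3 := qPoch_sq_mul_euler hq
  have h5 := qPoch_sq_mul_euler hq2
  rw [theta_eq_qPoch (by rw [h4]; exact dvd_pow hq four_ne_zero), h4, ← h3]
  simp only [← pow_mul] at *
  norm_num at *
  rw [show q * q ^ 2 = q ^ 3 by ring] at h1
  change _ * _ * euler (q ^ 4) * _ = _
  linear_combination (-qPoch q (q ^ 2) * euler (q ^ 4) * euler (q ^ 2)) * h1 +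
    euler (q ^ 2) * euler (q ^ 4) * h2 + euler (q ^ 2) * h5

/-- Follows from Euler's identity `(-q; q)(q; q^2) = 1`, split into residue classes mod 3 (`k1`),
divided by the same identity for `q^3` (`k2`). -/
theorem theta_mul_theta_eq_euler {q : ℤ⟦X⟧} (hq : X ∣ q) :
    theta q (q ^ 2) * theta (-q) (-q ^ 5) = euler (q ^ 3) * euler (q ^ 6) := by
  have hq2 : X ∣ q ^ 2 := dvd_pow hq two_ne_zero
  have hq3 : X ∣ q ^ 3 := dvd_pow hq three_ne_zero
  have e3 : q * q ^ 2 = q ^ 3 := by ring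
  have e6 : -q * -q ^ 5 = q ^ 6 := by ring
  have h1 := qPoch_three (-q) q hq
  have h2 := qPoch_neg_mul_euler hq3
  have h3 := qPoch_neg_mul_euler hq
  have h4 := qPoch_three q (q ^ 2) hq2
  have h5 := qPoch_sq_mul_euler hq
  have h6 := qPoch_sq_mul_euler hq3
  rw [theta_eq_qPoch (by rw [e3]; exact hq3),
    theta_eq_qPoch (by rw [e6]; exact dvd_pow hq (by simp)), e3, e6]
  have n1 := euler_ne_zero hq
  have n2 := euler_ne_zero hq2
  have n3 := euler_ne_zero hq3
  have n6 := euler_ne_zero (dvd_pow hq (show 6 ≠ 0 by simp))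
  simp only [← pow_mul, ← pow_succ', neg_mul, neg_neg] at *
  norm_num at *
  rw [← sq] at h1
  change _ * euler (q ^ 3) * (_ * euler (q ^ 6)) = _
  generalize qPoch (-q) (q ^ 3) = a1 at *
  generalize qPoch (-q ^ 2) (q ^ 3) = a2 at *
  generalize qPoch (-q ^ 3) (q ^ 3) = a3 at *
  generalize qPoch q (q ^ 6) = b1 at *
  generalize qPoch (q ^ 3) (q ^ 6) = b3 at *
  generalize qPoch (q ^ 5) (q ^ 6) = b5 at *
  have k1 : a1 * a2 * a3 * (b1 * b3 * b5) = 1 := by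
    refine mul_right_cancel₀ (mul_ne_zero n1 n2) ?_
    rw [← h1, ← h4]
    linear_combination (qPoch q (q ^ 2) * euler (q ^ 2)) * h3 + euler (q ^ 2) * h5
  have k2 : a3 * b3 = 1 := by
    refine mul_right_cancel₀ (mul_ne_zero n3 n6) ?_
    linear_combination b3 * euler (q ^ 6) * h2 + euler (q ^ 6) * h6
  linear_combination euler (q ^ 3) * euler (q ^ 6) * k1 -
    euler (q ^ 3) * euler (q ^ 6) * a1 * a2 * b1 * b5 * k2

/-! ### Series supported on residue classes of exponents -/

/-- The power series in `X ^ m`. -/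
def supportSubring (m : ℕ) : Subring ℤ⟦X⟧ where
  carrier := {f | ∀ n, ¬ m ∣ n → coeff n f = 0}
  zero_mem' n _ := by simp
  one_mem' n hn := by
    rw [coeff_one, if_neg]
    rintro rfl
    exact hn (dvd_zero m)
  add_mem' hf hg n hn := by rw [map_add, hf n hn, hg n hn, add_zero]
  neg_mem' hf n hn := by rw [map_neg, hf n hn, neg_zero]
  mul_mem' := by
    intro f g hf hg n hn
    rw [coeff_mul]
    refine sum_eq_zero fun x hx => ?_
    by_cases h1 : m ∣ x.1
    · rw [hg x.2 fun h2 => hn (mem_antidiagonal.mp hx ▸ dvd_add h1 h2), mul_zero]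
    · rw [hf x.1 h1, zero_mul]

theorem X_pow_mem_supportSubring {m k : ℕ} (h : m ∣ k) : X ^ k ∈ supportSubring m := fun n hn => by
  rw [coeff_X_pow, if_neg]
  rintro rfl
  exact hn h

theorem isClosed_supportSubring (m : ℕ) : IsClosed (supportSubring m : Set ℤ⟦X⟧) := by
  change IsClosed {f : ℤ⟦X⟧ | ∀ n, ¬ m ∣ n → coeff n f = 0}
  simp_rw [Set.ofPred_forall]
  exact isClosed_iInter fun n => isClosed_iInter fun _ =>
    isClosed_eq (WithPiTopology.continuous_coeff ℤ n) continuous_const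

theorem mem_supportSubring_of_hasSum {ι : Type*} {m : ℕ} {f : ι → ℤ⟦X⟧} {s : ℤ⟦X⟧}
    (hf : HasSum f s) (h : ∀ i, f i ∈ supportSubring m) : s ∈ supportSubring m :=
  (isClosed_supportSubring m).mem_of_tendsto hf <| Eventually.of_forall
    fun _ => sum_mem fun i _ => h i

theorem theta_mem_supportSubring {m : ℕ} {a b : ℤ⟦X⟧} (hq : X ∣ a * b) (ha : a ∈ supportSubring m)
    (hb : b ∈ supportSubring m) : theta a b ∈ supportSubring m :=
  mem_supportSubring_of_hasSum (hasSum_theta hq) fun _ => mul_mem (pow_mem ha _) (pow_mem hb _)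

theorem euler_mem_supportSubring {m : ℕ} {q : ℤ⟦X⟧} (hq : X ∣ q) (h : q ∈ supportSubring m) :
    euler q ∈ supportSubring m :=
  (isClosed_supportSubring m).mem_of_tendsto (tendsto_qPoch q q hq) <| Eventually.of_forall
    fun _ => prod_mem fun _ _ => sub_mem (one_mem _) (mul_mem h (pow_mem h _))

theorem coeff_X_pow_mul_eq_zero {m s n : ℕ} {f : ℤ⟦X⟧} (hf : f ∈ supportSubring m)
    (h : ∀ k, s + m * k ≠ n) : coeff n (X ^ s * f) = 0 := by
  rw [coeff_X_pow_mul']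
  split_ifs with hs
  · refine hf _ fun ⟨k, hk⟩ => h k ?_
    lia
  · rfl

/-- The part of a power series supported on the exponents that are `r` modulo `m`. -/
noncomputable def residuePart (m r : ℕ) : ℤ⟦X⟧ →+ ℤ⟦X⟧ where
  toFun f := mk fun n => if n % m = r then coeff n f else 0
  map_zero' := by ext; simp
  map_add' f g := by
    ext n
    simp only [coeff_mk, map_add]
    split_ifs <;> simp

theorem coeff_residuePart (m r n : ℕ) (f : ℤ⟦X⟧) :
    coeff n (residuePart m r f) = if n % m = r then coeff n f else 0 :=
  coeff_mk n fun n => if n % m = r then coeff n f else 0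

/-- Linearity over series in `X ^ m`; it lets residue parts be read off a dissection. -/
theorem residuePart_mul {m : ℕ} (r : ℕ) (f : ℤ⟦X⟧) {g : ℤ⟦X⟧} (hg : g ∈ supportSubring m) :
    residuePart m r (f * g) = residuePart m r f * g := by
  ext n
  rw [coeff_residuePart, coeff_mul, coeff_mul]
  have key : ∀ x ∈ antidiagonal n, coeff x.1 (residuePart m r f) * coeff x.2 g =
      if n % m = r then coeff x.1 f * coeff x.2 g else 0 := by
    intro x hx
    rw [coeff_residuePart, ite_mul, zero_mul]
    by_cases h : m ∣ x.2
    · obtain ⟨k, hk⟩ := h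
      rw [← mem_antidiagonal.mp hx, hk, Nat.add_mul_mod_self_left]
    · simp [hg x.2 h]
  rw [sum_congr rfl key]
  split_ifs <;> simp

theorem residuePart_X_pow (m r s : ℕ) :
    residuePart m r (X ^ s) = if s % m = r then X ^ s else 0 := by
  ext n
  rw [coeff_residuePart, coeff_X_pow]
  by_cases h : n = s
  · subst h
    rw [if_pos rfl]
    split_ifs <;> simp
  · split_ifs <;> simp [coeff_X_pow, h]

/-! ### The 2-dissection of `E_1^2 E_3^2` and cubes modulo 3 -/

/-- Multiply the dissection of `φ(-q)φ(-q^3)`, `q = X ^ m`, by `E_2 E_6`. The odd part becomes `-2q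
E_4^2 E_12^2`, whose cofactor of `q` is a series in `q^4`, not merely in `q^2`; the mod 8 argument
depends on this. -/
theorem exists_dissection_euler_sq_mul {m : ℕ} (hm : m ≠ 0) :
    ∃ A ∈ supportSubring (2 * m), ∃ B ∈ supportSubring (4 * m),
      euler (X ^ m) ^ 2 * euler (X ^ (3 * m)) ^ 2 = A + X ^ m * B := by
  have hX (k : ℕ) : X ∣ (X ^ m : ℤ⟦X⟧) ^ (k + 1) := dvd_pow (dvd_pow_self X hm) (by simp)
  have hq : X ∣ (X ^ m : ℤ⟦X⟧) := dvd_pow_self X hm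
  obtain ⟨e, E, hE, h⟩ := theta_mul_theta_dissection (hq.neg_right)
  have h1 := theta_neg_neg_mul hq
  have h2 := theta_neg_neg_mul (hX 2)
  have h3 := theta_pow_three_mul (hX 1)
  have h4 := theta_pow_three_mul (hX 5)
  have k2 : (X ^ m : ℤ⟦X⟧) ^ 2 ∈ supportSubring (2 * m) := by
    rw [← pow_mul]; exact X_pow_mem_supportSubring (by simp [mul_comm])
  have k4 : (X ^ m : ℤ⟦X⟧) ^ 4 ∈ supportSubring (4 * m) := by
    rw [← pow_mul]; exact X_pow_mem_supportSubring (by simp [mul_comm])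
  have k6 : (X ^ m : ℤ⟦X⟧) ^ 6 ∈ supportSubring (2 * m) := by
    rw [show (X ^ m : ℤ⟦X⟧) ^ 6 = ((X ^ m) ^ 2) ^ 3 by ring]; exact pow_mem k2 3
  have k12 : (X ^ m : ℤ⟦X⟧) ^ 12 ∈ supportSubring (4 * m) := by
    rw [show (X ^ m : ℤ⟦X⟧) ^ 12 = ((X ^ m) ^ 4) ^ 3 by ring]; exact pow_mem k4 3
  have hE' : E ∈ supportSubring (2 * m) :=
    mem_supportSubring_of_hasSum hE fun x => pow_mem (by rwa [neg_sq]) _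
  rw [show X ^ (3 * m) = ((X : ℤ⟦X⟧) ^ m) ^ 3 by rw [← pow_mul, mul_comm]]
  generalize (X ^ m : ℤ⟦X⟧) = q at *
  refine ⟨E * (euler (q ^ 2) * euler (q ^ 6)),
    mul_mem hE' (mul_mem (euler_mem_supportSubring (hX 1) k2) (euler_mem_supportSubring (hX 5) k6)),
    -2 * (euler (q ^ 4) ^ 2 * euler (q ^ 12) ^ 2),
    mul_mem (neg_mem (ofNat_mem _ 2)) (mul_mem (pow_mem (euler_mem_supportSubring (hX 3) k4) _)
      (pow_mem (euler_mem_supportSubring (hX 11) k12) _)), ?_⟩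
  rw [show (-q) ^ 3 = -q ^ 3 by ring, show (-q) ^ 2 = q ^ 2 by ring,
    show (-q) ^ 6 = q ^ 6 by ring, show (-q) ^ 18 = q ^ 18 by ring] at h
  simp only [← pow_mul, Nat.reduceAdd, Nat.reduceMul] at h1 h2 h3 h4
  rw [← h1, ← h2, ← h3, ← h4]
  linear_combination (euler (q ^ 2) * euler (q ^ 6)) * h

/-- Factorwise, `(1 - x)^3 ≡ 1 - x^3` mod 3, and divisibility by 3 is a closed condition, so it
passes to the infinite product. -/
theorem three_dvd_euler_pow_sub {q : ℤ⟦X⟧} (hq : X ∣ q) : 3 ∣ euler q ^ 3 - euler (q ^ 3) := by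
  have hcl : IsClosed {f : ℤ⟦X⟧ | 3 ∣ f} := by
    have : {f : ℤ⟦X⟧ | 3 ∣ f} = ⋂ n, coeff n ⁻¹' {x : ℤ | 3 ∣ x} := by
      ext f
      simp only [Set.mem_ofPred_eq, Set.mem_iInter, Set.mem_preimage]
      constructor
      · rintro ⟨g, rfl⟩ n
        exact ⟨coeff n g, by rw [← map_ofNat (C (R := ℤ)) 3, coeff_C_mul]⟩
      · intro h
        choose g hg using h
        exact ⟨mk g, by ext n; rw [← map_ofNat (C (R := ℤ)) 3, coeff_C_mul, coeff_mk, hg]⟩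
    rw [this]
    exact isClosed_iInter fun n =>
      (isClosed_discrete _).preimage (WithPiTopology.continuous_coeff ℤ n)
  refine hcl.mem_of_tendsto (((tendsto_qPoch q q hq).pow 3).sub
    (tendsto_qPoch (q ^ 3) (q ^ 3) (dvd_pow hq three_ne_zero))) (Eventually.of_forall fun n => ?_)
  rw [Set.mem_ofPred_eq]
  induction n with
  | zero => simp
  | succ n ih =>
    rw [prod_range_succ, prod_range_succ]
    obtain ⟨u, hu⟩ := ih
    have hv : (1 - q * q ^ n) ^ 3 - (1 - q ^ 3 * (q ^ 3) ^ n) =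
      3 * (-(q * q ^ n) + (q * q ^ n) ^ 2) := by ring
    generalize ∏ k ∈ range n, (1 - q * q ^ k) = f at *
    generalize ∏ k ∈ range n, (1 - q ^ 3 * (q ^ 3) ^ k) = g at *
    exact ⟨u * (1 - q * q ^ n) ^ 3 + g * (-(q * q ^ n) + (q * q ^ n) ^ 2),
      by linear_combination (1 - q * q ^ n) ^ 3 * hu + g * hv⟩

theorem X_dvd_X_pow {k : ℕ} (hk : k ≠ 0) : X ∣ (X ^ k : ℤ⟦X⟧) := dvd_pow_self X hk

theorem constantCoeff_euler {q : ℤ⟦X⟧} (hq : X ∣ q) : constantCoeff (euler q) = 1 :=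
  constantCoeff_qPoch q q (X_dvd_iff.mp hq) (X_dvd_iff.mp hq)

theorem theta_one_eq {q : ℤ⟦X⟧} (hq : X ∣ q) : theta 1 q = 2 * theta q (q ^ 3) :=
  mul_right_cancel₀ (euler_ne_zero hq) (by
    rw [theta_one_mul hq, mul_assoc, theta_pow_three_mul hq])

theorem theta_pow_three_dissection {q : ℤ⟦X⟧} (hq : X ∣ q) :
    theta q (q ^ 3) = theta (q ^ 3) (q ^ 6) + q * theta (q ^ 9) (q ^ 27) := by
  have h := theta_one_dissection hq
  rw [theta_one_eq hq, theta_one_eq (dvd_pow hq (show 9 ≠ 0 by simp)), ← pow_mul] at h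
  refine mul_left_cancel₀ (show (2 : ℤ⟦X⟧) ≠ 0 from fun h0 => ?_) ?_
  · have h2 := congrArg constantCoeff h0
    rw [map_ofNat, map_zero] at h2
    exact two_ne_zero h2
  linear_combination h

/-! ### The generating function: divisibility by 9 -/

theorem genFun_three_mul :
    genFun 3 * (theta (-X) (-X) * euler (X ^ 3) ^ 2) = theta X (X ^ 3) ^ 2 := by
  have h := genFun_mul_denom 3 three_ne_zero
  have hX : X ∣ (X : ℤ⟦X⟧) := dvd_rfl
  have h1 := theta_neg_neg_mul hX
  have h2 := theta_pow_three_mul hX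
  have h3 := qPoch_sq_mul_euler hX
  have n2 := euler_ne_zero (X_dvd_X_pow two_ne_zero)
  rw [denom] at h
  change _ * (_ * euler (X ^ 3) ^ 2) = euler (X ^ 2) at h
  generalize qPoch X (X ^ 2) = c at *
  generalize theta X (X ^ 3) = ψ at *
  have nc : c ≠ 0 := by
    rintro rfl
    exact euler_ne_zero hX (by rw [← h3, zero_mul])
  have k1 : theta (-X) (-X) = c ^ 2 * euler (X ^ 2) := by
    refine mul_right_cancel₀ n2 ?_
    rw [h1, ← h3]; ring
  have k2 : ψ * c = euler (X ^ 2) := by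
    refine mul_right_cancel₀ n2 ?_
    linear_combination h2 + ψ * h3
  have k3 : genFun 3 * (c ^ 3 * euler (X ^ 3) ^ 2) = ψ := by
    refine mul_right_cancel₀ nc ?_
    linear_combination h - k2
  rw [k1]
  linear_combination ψ * k3 - genFun 3 * c ^ 2 * euler (X ^ 3) ^ 2 * k2

/-- `D` is a common denominator supported on multiples of 3; `N` records that it agrees with
`φ(-q)^3` mod 3. -/
theorem exists_residuePart_genFun_three : ∃ D N : ℤ⟦X⟧,
    constantCoeff D = 1 ∧ (theta (-X) (-X)) ^ 3 = D + 3 * N ∧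
    residuePart 3 2 (genFun 3) * (euler (X ^ 3) ^ 2 * D) =
      9 * (X ^ 2 * (euler (X ^ 9) ^ 2 * euler (X ^ 18) ^ 2)) := by
  have hX : X ∣ (X : ℤ⟦X⟧) := dvd_rfl
  have mem {k : ℕ} (hk : 3 ∣ k) : (X ^ k : ℤ⟦X⟧) ∈ supportSubring 3 :=
    X_pow_mem_supportSubring hk
  have hφ := theta_self_dissection (hX.neg_right)
  have hψ := theta_pow_three_dissection hX
  have hG := genFun_three_mul
  have haO := theta_mul_theta_eq_euler (q := X ^ 3) (X_dvd_X_pow (by simp))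
  have hψ9 := theta_pow_three_mul (q := X ^ 9) (X_dvd_X_pow (by simp))
  have hP := theta_neg_neg_mul (q := X ^ 9) (X_dvd_X_pow (by simp))
  simp only [← pow_mul, Nat.reduceMul] at haO hψ9 hP
  rw [show (-X : ℤ⟦X⟧) ^ 9 = -X ^ 9 by ring, show (-X : ℤ⟦X⟧) ^ 3 = -X ^ 3 by ring,
    show (-X : ℤ⟦X⟧) ^ 15 = -X ^ 15 by ring] at hφ
  have mP : theta (-X ^ 9) (-X ^ 9) ∈ supportSubring 3 := theta_mem_supportSubring
    ((X_dvd_X_pow (by simp)).neg_right.mul_right _) (neg_mem (mem (by simp)))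
    (neg_mem (mem (by simp)))
  have mO : theta (-X ^ 3) (-X ^ 15) ∈ supportSubring 3 := theta_mem_supportSubring
    ((X_dvd_X_pow (by simp)).neg_right.mul_right _) (neg_mem (mem (by simp)))
    (neg_mem (mem (by simp)))
  have ma : theta (X ^ 3) (X ^ 6) ∈ supportSubring 3 := theta_mem_supportSubring
    ((X_dvd_X_pow (by simp)).mul_right _) (mem (by simp)) (mem (by simp))
  have mψ : theta (X ^ 9) (X ^ 27) ∈ supportSubring 3 := theta_mem_supportSubring
    ((X_dvd_X_pow (by simp)).mul_right _) (mem (by simp)) (mem (by simp))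
  have m3 : euler (X ^ 3) ∈ supportSubring 3 :=
    euler_mem_supportSubring (X_dvd_X_pow (by simp)) (mem (by simp))
  have mX := mem dvd_rfl
  have cP : constantCoeff (theta (-X ^ 9) (-X ^ 9)) = 1 := by
    simpa [constantCoeff_euler, X_dvd_X_pow] using congrArg constantCoeff hP
  have n9 := euler_ne_zero (X_dvd_X_pow (show 9 ≠ 0 by simp))
  have n18 := euler_ne_zero (X_dvd_X_pow (show 18 ≠ 0 by simp))
  rw [hφ, hψ] at hG
  rw [hφ]
  generalize theta (-X ^ 9) (-X ^ 9) = P at *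
  generalize theta (-X ^ 3) (-X ^ 15) = O at *
  generalize theta (X ^ 3) (X ^ 6) = a at *
  generalize theta (X ^ 9) (X ^ 27) = ψ at *
  generalize euler (X ^ 3) = e3 at *
  have hψP : ψ * P = euler (X ^ 9) * euler (X ^ 18) := by
    refine mul_right_cancel₀ (mul_ne_zero n9 n18) ?_
    linear_combination P * euler (X ^ 18) * hψ9 + euler (X ^ 18) ^ 2 * hP
  generalize euler (X ^ 9) = e9 at *
  generalize euler (X ^ 18) = e18 at *
  -- `D` is `φ(-q) = P - 2XO` times its cofactor `P^2 + 2XPO + 4X^2O^2`; `N` collects the mixed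
  -- terms of `(P - 2XO)^3`.
  refine ⟨P ^ 3 - 8 * X ^ 3 * O ^ 3, -2 * X * P ^ 2 * O + 4 * X ^ 2 * P * O ^ 2, ?_, by ring, ?_⟩
  · simp [cP]
  have hD : P ^ 3 - 8 * X ^ 3 * O ^ 3 ∈ supportSubring 3 :=
    sub_mem (pow_mem mP 3) (mul_mem (mul_mem (ofNat_mem _ 8) mX) (pow_mem mO 3))
  have h0 : a ^ 2 * P ^ 2 + X ^ 3 * (2 * ψ ^ 2 * P * O + 8 * a * ψ * O ^ 2) ∈ supportSubring 3 :=
    add_mem (mul_mem (pow_mem ma 2) (pow_mem mP 2)) (mul_mem mX (add_mem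
      (mul_mem (mul_mem (mul_mem (ofNat_mem _ 2) (pow_mem mψ 2)) mP) mO)
      (mul_mem (mul_mem (mul_mem (ofNat_mem _ 8) ma) mψ) (pow_mem mO 2))))
  have h1 : 2 * a * ψ * P ^ 2 + 2 * a ^ 2 * P * O + X ^ 3 * (4 * ψ ^ 2 * O ^ 2) ∈
      supportSubring 3 :=
    add_mem (add_mem (mul_mem (mul_mem (mul_mem (ofNat_mem _ 2) ma) mψ) (pow_mem mP 2))
      (mul_mem (mul_mem (mul_mem (ofNat_mem _ 2) (pow_mem ma 2)) mP) mO))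
      (mul_mem mX (mul_mem (mul_mem (ofNat_mem _ 4) (pow_mem mψ 2)) (pow_mem mO 2)))
  have h2 : (ψ * P) ^ 2 + 4 * (a * O) * (ψ * P) + 4 * (a * O) ^ 2 ∈ supportSubring 3 :=
    add_mem (add_mem (pow_mem (mul_mem mψ mP) 2) (mul_mem (mul_mem (ofNat_mem _ 4)
      (mul_mem ma mO)) (mul_mem mψ mP))) (mul_mem (ofNat_mem _ 4) (pow_mem (mul_mem ma mO) 2))
  have hmain : genFun 3 * (e3 ^ 2 * (P ^ 3 - 8 * X ^ 3 * O ^ 3)) =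
      X ^ 0 * (a ^ 2 * P ^ 2 + X ^ 3 * (2 * ψ ^ 2 * P * O + 8 * a * ψ * O ^ 2)) +
      X ^ 1 * (2 * a * ψ * P ^ 2 + 2 * a ^ 2 * P * O + X ^ 3 * (4 * ψ ^ 2 * O ^ 2)) +
      X ^ 2 * ((ψ * P) ^ 2 + 4 * (a * O) * (ψ * P) + 4 * (a * O) ^ 2) := by
    linear_combination (P ^ 2 + 2 * X * P * O + 4 * X ^ 2 * O ^ 2) * hG
  rw [← residuePart_mul 2 _ (mul_mem (pow_mem m3 2) hD), hmain, map_add, map_add,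
    residuePart_mul 2 _ h0, residuePart_mul 2 _ h1, residuePart_mul 2 _ h2, residuePart_X_pow,
    residuePart_X_pow, residuePart_X_pow, haO, hψP]
  simp
  ring

/-! ### The remaining factor 3 -/

theorem coeff_theta_mul_eq_zero (n : ℕ) :
    coeff (24 * n + 23) (X ^ 2 * (theta (-X ^ 3) (-X ^ 3) *
      (euler (X ^ 6) ^ 2 * euler (X ^ 18) ^ 2)) : ℤ⟦X⟧) = 0 := by
  obtain ⟨A, hA, B, hB, h⟩ := exists_dissection_euler_sq_mul (m := 6) (by simp)
  norm_num at hA hB h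
  rw [h]
  have hq : X ∣ (-X ^ 3 * -X ^ 3 : ℤ⟦X⟧) := (X_dvd_X_pow three_ne_zero).neg_right.mul_right _
  have hs := (((hasSum_theta hq).mul_right (A + X ^ 6 * B)).mul_left (X ^ 2)).map
    (coeff (24 * n + 23))
    (WithPiTopology.continuous_coeff ℤ _)
  refine hs.unique ?_
  convert hasSum_zero with j
  have t1 := two_mul_triangular j
  have t2 := two_mul_triangular (-j)
  have hj : ((triangular j + triangular (-j) : ℕ) : ℤ) = j * j := by push_cast; linarith
  have e : X ^ 2 * (thetaTerm (-X ^ 3) (-X ^ 3) j * (A + X ^ 6 * B)) =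
      X ^ (2 + 3 * (triangular j + triangular (-j))) *
        ((-1) ^ (triangular j + triangular (-j)) * A) +
      X ^ (8 + 3 * (triangular j + triangular (-j))) *
        ((-1) ^ (triangular j + triangular (-j)) * B) := by
    rw [thetaTerm, ← pow_add, neg_pow, ← pow_mul]; ring
  -- An exponent `24n + 23` would need `j^2 ≡ 3` mod 4 in the `A` part, or `j^2 ≡ 5` mod 8 in the
  -- `B` part.
  have hm : j * j % 8 = 0 ∨ j * j % 8 = 1 ∨ j * j % 8 = 4 := by
    have : j % 8 = 0 ∨ j % 8 = 1 ∨ j % 8 = 2 ∨ j % 8 = 3 ∨ j % 8 = 4 ∨ j % 8 = 5 ∨ j % 8 = 6 ∨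
      j % 8 = 7 := by lia
    rcases this with h | h | h | h | h | h | h | h <;> simp [Int.mul_emod, h]
  rw [Function.comp_apply, e, map_add, coeff_X_pow_mul_eq_zero
    (mul_mem (pow_mem (neg_mem (one_mem _)) _) hA) (fun k => by lia), coeff_X_pow_mul_eq_zero
    (mul_mem (pow_mem (neg_mem (one_mem _)) _) hB) (fun k => by lia), add_zero]

theorem map_eq_map_of_dvd {f g : ℤ⟦X⟧} (h : 3 ∣ f - g) :
    PowerSeries.map (Int.castRingHom (ZMod 3)) f = PowerSeries.map (Int.castRingHom (ZMod 3)) g := by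
  obtain ⟨u, hu⟩ := h
  rw [← sub_eq_zero, ← map_sub, hu, map_mul, map_ofNat,
    show (3 : (ZMod 3)⟦X⟧) = C (3 : ZMod 3) from (map_ofNat C 3).symm, show (3 : ZMod 3) = 0 from rfl,
    map_zero, zero_mul]

theorem coeff_modEq_of_map_eq {f g : ℤ⟦X⟧}
    (h : PowerSeries.map (Int.castRingHom (ZMod 3)) f =
      PowerSeries.map (Int.castRingHom (ZMod 3)) g) (n : ℕ) :
    coeff n f ≡ coeff n g [ZMOD 3] := by
  have := congrArg (coeff n) h
  rw [coeff_map, coeff_map] at this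
  exact (ZMod.intCast_eq_intCast_iff _ _ 3).mp this

/-- Modulo 3, `H = q^2 E_9^2 E_18^2 / (E_3^2 D)` with `E_9 ≡ E_3^3` and `D ≡ φ(-q)^3 ≡ E_3^2/E_6`.
Hence `H ≡ q^2 E_3^2 E_6 E_18^2`, where `E_3^2 = φ(-q^3) E_6`. -/
theorem exists_nine_mul_eq_residuePart : ∃ H : ℤ⟦X⟧, residuePart 3 2 (genFun 3) = 9 * H ∧
    PowerSeries.map (Int.castRingHom (ZMod 3)) H = PowerSeries.map (Int.castRingHom (ZMod 3))
      (X ^ 2 * (theta (-X ^ 3) (-X ^ 3) * (euler (X ^ 6) ^ 2 * euler (X ^ 18) ^ 2))) := by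
  obtain ⟨D, N, hD, hN, hG⟩ := exists_residuePart_genFun_three
  have c3 := constantCoeff_euler (X_dvd_X_pow three_ne_zero)
  have hc : constantCoeff (euler (X ^ 3) ^ 2 * D) = 1 := by simp [c3, hD]
  have hinv := mul_invOfUnit (euler (X ^ 3) ^ 2 * D) 1 (by simpa using hc)
  generalize invOfUnit (euler (X ^ 3) ^ 2 * D) 1 = I at *
  have hH : (X ^ 2 * (euler (X ^ 9) ^ 2 * euler (X ^ 18) ^ 2) * I) * (euler (X ^ 3) ^ 2 * D) =
      X ^ 2 * (euler (X ^ 9) ^ 2 * euler (X ^ 18) ^ 2) := by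
    linear_combination (X ^ 2 * (euler (X ^ 9) ^ 2 * euler (X ^ 18) ^ 2)) * hinv
  refine ⟨X ^ 2 * (euler (X ^ 9) ^ 2 * euler (X ^ 18) ^ 2) * I, ?_, ?_⟩
  · linear_combination I * hG - residuePart 3 2 (genFun 3) * hinv
  have f1 := map_eq_map_of_dvd (f := theta (-X) (-X) ^ 3) (g := D) ⟨N, by rw [hN]; ring⟩
  have frob (k : ℕ) (hk : k ≠ 0) := map_eq_map_of_dvd (three_dvd_euler_pow_sub (X_dvd_X_pow hk))
  have f2 := frob 2 two_ne_zero
  have f3 := frob 3 three_ne_zero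
  have f4 := frob 6 (by simp)
  have f5 := frob 1 one_ne_zero
  have g1 := congrArg (PowerSeries.map (Int.castRingHom (ZMod 3)))
    (theta_neg_neg_mul (q := X) dvd_rfl)
  have g2 := congrArg (PowerSeries.map (Int.castRingHom (ZMod 3)))
    (theta_neg_neg_mul (q := X ^ 3) (X_dvd_X_pow three_ne_zero))
  have hH := congrArg (PowerSeries.map (Int.castRingHom (ZMod 3))) hH
  have n3 : PowerSeries.map (Int.castRingHom (ZMod 3)) (euler (X ^ 3)) ≠ 0 := fun h => by
    have := congrArg (coeff 0) h
    rw [coeff_map, coeff_zero_eq_constantCoeff, c3] at this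
    simp at this
  generalize X ^ 2 * (euler (X ^ 9) ^ 2 * euler (X ^ 18) ^ 2) * I = H at *
  simp only [map_mul, map_pow, ← pow_mul, Nat.reduceMul, pow_one] at *
  rw [← f1, ← f3, ← f4] at hH
  rw [← f4]
  -- One `E_3^2` clears the denominator of `H`, the other is replaced by `φ(-q)^3 E_6` through `k1`.
  refine mul_right_cancel₀ (pow_ne_zero 4 n3) ?_
  set M := PowerSeries.map (Int.castRingHom (ZMod 3))
  have k1 : M (theta (-X) (-X)) ^ 3 * M (euler (X ^ 6)) = M (euler (X ^ 3)) ^ 2 := by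
    rw [← f2, ← f5, ← mul_pow, g1]; ring
  generalize M (euler (X ^ 3)) = e3 at *
  generalize M (euler (X ^ 6)) = e6 at *
  generalize M (theta (-X) (-X)) = φ at *
  generalize M (theta (-X ^ 3) (-X ^ 3)) = φ3 at *
  linear_combination e6 * hH - M H * e3 ^ 2 * k1 - M X ^ 2 * e3 ^ 4 * e6 ^ 7 * g2

end WeightedPartition

theorem mainTheorem5 (n : ℕ) : WeightedPartition.w 3 (24 * n + 23) ≡ 0 [ZMOD 27] := by
  open WeightedPartition PowerSeries in
  obtain ⟨H, h1, h2⟩ := exists_nine_mul_eq_residuePart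
  have h3 := coeff_modEq_of_map_eq h2 (24 * n + 23)
  rw [coeff_theta_mul_eq_zero] at h3
  have h4 := congrArg (coeff (24 * n + 23)) h1
  rw [coeff_residuePart, if_pos (by lia), ← map_ofNat (C (R := ℤ)) 9, coeff_C_mul] at h4
  rw [w, h4]
  exact h3.mul_left' (c := 9)
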